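/- Let $H$ be a separable infinite-dimensional real Hilbert space, let $X_1,X_2,\dots$ be independent copies of an $H$-valued random element $X$, and let $x_0\in H$. A function $f$ is called $\Gamma$-varying at $0$ if there is a measurable positive function $\rho$ with $\lim_{h\to0^+} f(h+\rho(h)x)/f(h)=e^x$ for every $x\in\mathbb R$. Let $F(r)=\mathbb P(\|X-x_0\|<r)$ be the small ball probability, and assume throughout that $F$ is $\Gamma$-varying at $0$. Assume: (A1) there is an orthonormal basis $(e_p)$ of $H$ such that the coordinates $\langle X,e_p\rangle$ are independent and have densities $f_p$ that are twice differentiable at $\langle x_0,e_p\rangle$ with $f_p^{(i)}(\langle x_0,e_p\rangle)\ne0$ for $i=0,1,2$; and $\|X-x_0\|$ has in a neighbourhood of $0$ a density that is $\Gamma$-varying at $0$; (A2) $K:[0,\infty)\to[0,\infty)$ satisfies $\int_0^\infty K(s)\,ds=1$, is bounded, is supported in $[0,1]$, has $K(1)>0$, and is differentiable on $[0,1]$ (one-sidedly at the end points) with $\sup_{s\in[0,1]}|K'(s)|<\infty$. For $h>0$ and $n\ge1$ let, with $(u\otimes v)(t)=\langle u,t\rangle v$, $$\Gamma_K=\mathbb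 E\Big[K\Big(\tfrac{\|X-x_0\|}{h}\Big)(X-x_0)\otimes(X-x_0)\Big],\qquad \Gamma_{K,n}=\frac1n\sum_{k=1}^nK\Big(\tfrac{\|X_k-x_0\|}{h}\Big)(X_k-x_0)\otimes(X_k-x_0).$$ Write $\|T\|_2=\big(\sum_k\|Te_k\|^2\big)^{1/2}$ for the Hilbert-Schmidt norm and $\|T\|_\infty$ for the operator norm. Then, as $h\to0^+$ and uniformly in $n\ge1$, $$\mathbb E\|\Gamma_{K,n}-\Gamma_K\|_2^2=\frac{h^4F(h)}{n}K(1)^2\,(1+o(1)).$$ For the operator norm, $$\mathbb E\|\Gamma_{K,n}-\Gamma_K\|_\infty^2\le\frac{h^4F(h)}{n}K(1)^2\,(1+o(1))$$ as $h\to0^+$, uniformly in $n\ge1$, and equality holds (again up to the factor $1+o(1)$) as $h\to0^+$ and $nF(h)\to0$, in particular as $h\to0^+$ for each fixed $n$. -/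

import Mathlib

open MeasureTheory ProbabilityTheory Set Filter Topology
open scoped ENNReal InnerProductSpace

noncomputable section

/-- `f` is `Γ`-varying at `0` with auxiliary function `ρ`: for all real `x`,
`f (h + ρ h * x) / f h → exp x` as `h → 0+`. -/
def GammaVaryingWith (f ρ : ℝ → ℝ) : Prop :=
  Measurable ρ ∧ (∀ h, 0 < h → 0 < ρ h) ∧
    ∀ x : ℝ, Tendsto (fun h => f (h + ρ h * x) / f h) (𝓝[>] 0) (𝓝 (Real.exp x))

/-- The class `Γ` at `0`. -/
def GammaVarying (f : ℝ → ℝ) : Prop := ∃ ρ, GammaVaryingWith f ρ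

/-- A kernel on `[0, ∞)`, extended by zero to the negative half-line, which is bounded, supported
in `[0, 1]`, positive at `1`, and differentiable on `[0, 1]` with a bounded derivative
(one-sided at the end points). -/
structure KernelAssumption (K : ℝ → ℝ) : Prop where
  nonneg : ∀ s, 0 ≤ K s
  integral_eq_one : ∫ s in Ioi (0 : ℝ), K s = 1
  bounded : ∃ C, ∀ s, K s ≤ C
  support_subset : Function.support K ⊆ Icc 0 1
  pos_one : 0 < K 1
  differentiableOn : DifferentiableOn ℝ K (Icc 0 1)
  deriv_bounded : ∃ C, ∀ s ∈ Icc (0 : ℝ) 1, |derivWithin K (Icc 0 1) s| ≤ C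

variable {Ω H : Type*} [MeasurableSpace Ω] [NormedAddCommGroup H] [InnerProductSpace ℝ H]

/-- The small ball probability `F(r) = P(‖X - x₀‖ < r)`. -/
def smallBall (P : Measure Ω) (X : Ω → H) (x₀ : H) (r : ℝ) : ℝ :=
  P.real {ω | ‖X ω - x₀‖ < r}

/-- In some orthonormal basis the coordinates of `X` are independent with densities `f p`, each
twice differentiable at the matching coordinate of `x₀` with nonzero value and nonzero first
two derivatives there; and near `0` the law of `‖X - x₀‖` has a density `g` which is `Γ`-varying
at `0`. -/
def LawAssumption (P : Measure Ω) (X : Ω → H) (x₀ : H) : Prop :=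
  (∃ (e : HilbertBasis ℕ ℝ H) (f : ℕ → ℝ → ℝ),
    iIndepFun (fun p ω => ⟪X ω, e p⟫_ℝ) P ∧
    ∀ p, Measurable (f p) ∧ (∀ t, 0 ≤ f p t) ∧
      P.map (fun ω => ⟪X ω, e p⟫_ℝ) = volume.withDensity (fun t => ENNReal.ofReal (f p t)) ∧
      (∀ᶠ t in 𝓝 ⟪x₀, e p⟫_ℝ, DifferentiableAt ℝ (f p) t) ∧
      DifferentiableAt ℝ (deriv (f p)) ⟪x₀, e p⟫_ℝ ∧
      f p ⟪x₀, e p⟫_ℝ ≠ 0 ∧ deriv (f p) ⟪x₀, e p⟫_ℝ ≠ 0 ∧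
      deriv (deriv (f p)) ⟪x₀, e p⟫_ℝ ≠ 0) ∧
  ∃ (g ρ : ℝ → ℝ) (r : ℝ), 0 < r ∧ Measurable g ∧ (∀ t, 0 ≤ g t) ∧
    (P.map (fun ω => ‖X ω - x₀‖)).restrict (Ioo (-r) r) =
      (volume.withDensity (fun t => ENNReal.ofReal (g t))).restrict (Ioo (-r) r) ∧
    GammaVaryingWith g ρ

/-- The summand `K(‖x - x₀‖ / h) • (x - x₀) ⊗ (x - x₀)`, where `(u ⊗ v) t = ⟪u, t⟫ v`. -/
def localTerm (K : ℝ → ℝ) (x₀ : H) (h : ℝ) (x : H) : H →L[ℝ] H :=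
  K (‖x - x₀‖ / h) • InnerProductSpace.rankOne ℝ (x - x₀) (x - x₀)

/-- The theoretical local covariance operator `Γ_K`, a Bochner integral in `H →L[ℝ] H`. -/
def localCov (P : Measure Ω) (K : ℝ → ℝ) (X : Ω → H) (x₀ : H) (h : ℝ) : H →L[ℝ] H :=
  ∫ ω, localTerm K x₀ h (X ω) ∂P

/-- The empirical local covariance operator `Γ_{K,n}` of the sample `X 0, …, X (n - 1)`. -/
def empLocalCov (K : ℝ → ℝ) (X : ℕ → Ω → H) (x₀ : H) (h : ℝ) (n : ℕ) (ω : Ω) : H →L[ℝ] H :=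
  (n : ℝ)⁻¹ • ∑ k ∈ Finset.range n, localTerm K x₀ h (X k ω)

/-- The squared Hilbert-Schmidt norm, computed in an orthonormal basis. -/
def hsNormSq (b : HilbertBasis ℕ ℝ H) (T : H →L[ℝ] H) : ℝ≥0∞ :=
  ∑' k, ‖T (b k)‖ₑ ^ 2

end

/-! Write `Y` for `localTerm K x₀ h (X 0 ω)`. Independence reduces the Hilbert-Schmidt risk to one
summand: each matrix entry of the empirical operator is a sample mean, so the risk is the sum over
entries of `Var/n`. Entries vanish off the ball of radius `h`, so by Cauchy-Schwarz the squared mean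
costs at most the fraction `P(‖X - x₀‖ ≤ h)` of the second moment, and that probability tends to 0.
Since `Y` has rank one, its Hilbert-Schmidt and operator norms agree, and the risk is `E‖Y‖² / n` up
to `1 + o(1)` (`lintegral_hsNormSq_bounds`).

For `E‖Y‖² = h⁴ E[K(u)² u⁴]` with `u = ‖X - x₀‖ / h`, Γ-variation forces `F(sh) = o(F(h))` for every
`s < 1` (`GammaVarying.eventually_le_mul`). Thus, given `u ≤ 1`, the mass concentrates at `u = 1`,
which leaves `h⁴ F(h) K(1)²` (`eventually_integral_norm_localTerm_sq`).

The operator norm is at most the Hilbert-Schmidt norm, hence the upper bound. When `n F(h)` is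
small, typically at most one sample point meets the ball, so the sum is essentially of rank one and
nothing is lost; `norm_sum_sub_sq_ge` makes this quantitative. -/

/-! ### Variance of real sample means. -/

section SampleMean

variable {Ω : Type*} [MeasurableSpace Ω] {P : Measure Ω} [IsProbabilityMeasure P]

omit [IsProbabilityMeasure P] in
lemma variance_sum_range_of_iid {z : ℕ → Ω → ℝ} (hz : ∀ k, MemLp (z k) 2 P)
    (hindep : iIndepFun z P) (hident : ∀ k, IdentDistrib (z k) (z 0) P P) (n : ℕ) :
    Var[∑ k ∈ Finset.range n, z k; P] = n * Var[z 0; P] := by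
  rw [IndepFun.variance_sum (fun i _ => hz i) (fun i _ j _ hij => hindep.indepFun hij)]
  simp [fun k => (hident k).variance_eq]

lemma integral_sum_range_of_identDistrib {z : ℕ → Ω → ℝ} (hz : ∀ k, MemLp (z k) 2 P)
    (hident : ∀ k, IdentDistrib (z k) (z 0) P P) (n : ℕ) :
    ∫ ω, ∑ k ∈ Finset.range n, z k ω ∂P = n * ∫ ω, z 0 ω ∂P := by
  rw [integral_finsetSum _ (fun i _ => (hz i).integrable one_le_two)]
  simp [fun k => (hident k).integral_eq]

lemma lintegral_sq_sampleMean_sub {z : ℕ → Ω → ℝ} (hz : ∀ k, MemLp (z k) 2 P)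
    (hindep : iIndepFun z P) (hident : ∀ k, IdentDistrib (z k) (z 0) P P) {n : ℕ} (hn : 1 ≤ n) :
    ∫⁻ ω, ‖(n : ℝ)⁻¹ * ∑ k ∈ Finset.range n, z k ω - ∫ ω, z 0 ω ∂P‖ₑ ^ 2 ∂P =
      ENNReal.ofReal (Var[z 0; P] / n) := by
  have hn' : (n : ℝ) ≠ 0 := by positivity
  have hmem : MemLp (fun ω => (n : ℝ)⁻¹ * ∑ k ∈ Finset.range n, z k ω) 2 P :=
    (memLp_finsetSum _ (fun i _ => hz i)).const_mul _
  have hmean : ∫ ω, (n : ℝ)⁻¹ * ∑ k ∈ Finset.range n, z k ω ∂P = ∫ ω, z 0 ω ∂P := by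
    rw [integral_const_mul, integral_sum_range_of_identDistrib hz hident]
    field_simp
  have hvar : Var[fun ω => (n : ℝ)⁻¹ * ∑ k ∈ Finset.range n, z k ω; P] = Var[z 0; P] / n := by
    rw [variance_const_mul]
    have : (fun ω => ∑ k ∈ Finset.range n, z k ω) = ∑ k ∈ Finset.range n, z k := by
      ext ω; simp
    rw [this, variance_sum_range_of_iid hz hindep hident]
    field_simp
  rw [← hvar, ofReal_variance hmem, evariance, hmean]

/-- Cauchy-Schwarz for a function vanishing off a set `S`. -/
lemma sq_integral_le_measureReal_mul {z : Ω → ℝ} (hz : MemLp z 2 P) {S : Set Ω}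
    (hS : MeasurableSet S) (hzS : ∀ ω, ω ∉ S → z ω = 0) :
    (∫ ω, z ω ∂P) ^ 2 ≤ P.real S * ∫ ω, z ω ^ 2 ∂P := by
  have hI : Integrable (S.indicator (fun _ => (1 : ℝ))) P := (integrable_const _).indicator hS
  have hz1 : Integrable z P := hz.integrable one_le_two
  have hz2 : Integrable (fun ω => z ω ^ 2) P := hz.integrable_sq
  -- The quadratic is the integral of `(z + t 1_S)²`, so its discriminant is nonpositive.
  have key : ∀ t : ℝ, 0 ≤ P.real S * (t * t) + (2 * ∫ ω, z ω ∂P) * t + ∫ ω, z ω ^ 2 ∂P := by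
    intro t
    have h1 : ∫ ω, (z ω + t * S.indicator (fun _ => (1 : ℝ)) ω) ^ 2 ∂P =
        P.real S * (t * t) + (2 * ∫ ω, z ω ∂P) * t + ∫ ω, z ω ^ 2 ∂P := by
      have : ∀ ω, (z ω + t * S.indicator (fun _ => (1 : ℝ)) ω) ^ 2 =
          z ω ^ 2 + (2 * t) * z ω + (t * t) * S.indicator (fun _ => (1 : ℝ)) ω := by
        intro ω
        by_cases hω : ω ∈ S
        · simp [hω]; ring
        · simp [hω, hzS ω hω]
      simp_rw [this]
      rw [integral_add (by fun_prop) (hI.const_mul _),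
        integral_add hz2 (hz1.const_mul _), integral_const_mul, integral_const_mul,
        integral_indicator hS]
      simp
      ring
    rw [← h1]
    exact integral_nonneg fun ω => sq_nonneg _
  have := discrim_le_zero key
  rw [discrim] at this
  nlinarith

end SampleMean

/-! ### Hilbert-Schmidt norm against operator norm. -/

section HilbertSchmidt

variable {H : Type*} [NormedAddCommGroup H] [InnerProductSpace ℝ H]

lemma HilbertBasis.tsum_enorm_inner_sq (b : HilbertBasis ℕ ℝ H) (x : H) :
    ∑' j, ‖⟪x, b j⟫_ℝ‖ₑ ^ 2 = ‖x‖ₑ ^ 2 := by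
  have h := b.hasSum_inner_mul_inner x x
  have h1 : ∀ j, ‖⟪x, b j⟫_ℝ‖ₑ ^ 2 = ENNReal.ofReal (⟪x, b j⟫_ℝ * ⟪b j, x⟫_ℝ) := by
    intro j
    rw [real_inner_comm x (b j), ← sq, ← enorm_pow, Real.enorm_of_nonneg (sq_nonneg _)]
  simp_rw [h1]
  rw [← ENNReal.ofReal_tsum_of_nonneg _ h.summable, h.tsum_eq, real_inner_self_eq_norm_sq,
    ENNReal.ofReal_pow (norm_nonneg _), ofReal_norm]
  intro j
  rw [real_inner_comm x (b j)]
  exact mul_self_nonneg _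

lemma hsNormSq_eq_tsum_tsum (b : HilbertBasis ℕ ℝ H) (T : H →L[ℝ] H) :
    hsNormSq b T = ∑' i, ∑' j, ‖⟪T (b i), b j⟫_ℝ‖ₑ ^ 2 := by
  simp_rw [hsNormSq, b.tsum_enorm_inner_sq]

lemma hsNormSq_adjoint [CompleteSpace H] (b : HilbertBasis ℕ ℝ H) (T : H →L[ℝ] H) :
    hsNormSq b (ContinuousLinearMap.adjoint T) = hsNormSq b T := by
  rw [hsNormSq_eq_tsum_tsum, hsNormSq_eq_tsum_tsum, ENNReal.tsum_comm]
  simp_rw [ContinuousLinearMap.adjoint_inner_left, real_inner_comm]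

/-- Parseval for `T x` has terms `⟪x, T* b j⟫²`; Cauchy-Schwarz bounds each by `‖x‖² ‖T* b j‖²`, and
the adjoint has the same Hilbert-Schmidt norm. -/
lemma enorm_apply_sq_le_hsNormSq [CompleteSpace H] (b : HilbertBasis ℕ ℝ H) (T : H →L[ℝ] H)
    (x : H) : ‖T x‖ₑ ^ 2 ≤ hsNormSq b T * ‖x‖ₑ ^ 2 := by
  rw [← hsNormSq_adjoint b T, ← b.tsum_enorm_inner_sq (T x), hsNormSq, ← ENNReal.tsum_mul_right]
  refine ENNReal.tsum_le_tsum fun j => ?_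
  rw [← mul_pow, ← ContinuousLinearMap.adjoint_inner_right, real_inner_comm]
  gcongr
  rw [← ofReal_norm, ← ofReal_norm, ← ofReal_norm, ← ENNReal.ofReal_mul (norm_nonneg _)]
  exact ENNReal.ofReal_le_ofReal (norm_inner_le_norm _ _)

lemma enorm_sq_le_hsNormSq [CompleteSpace H] (b : HilbertBasis ℕ ℝ H) (T : H →L[ℝ] H) :
    ‖T‖ₑ ^ 2 ≤ hsNormSq b T := by
  rcases eq_or_ne (hsNormSq b T) ∞ with h | h
  · simp [h]
  have h1 : ‖T‖ ≤ √(hsNormSq b T).toReal := by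
    refine ContinuousLinearMap.opNorm_le_bound _ (Real.sqrt_nonneg _) fun x => ?_
    have h2 := ENNReal.toReal_mono (ENNReal.mul_ne_top h (by simp))
      (enorm_apply_sq_le_hsNormSq b T x)
    simp only [ENNReal.toReal_mul, ENNReal.toReal_pow, toReal_enorm] at h2
    refine (sq_le_sq₀ (norm_nonneg _) (by positivity)).mp ?_
    rwa [mul_pow, Real.sq_sqrt ENNReal.toReal_nonneg]
  have h3 : ‖T‖ ^ 2 ≤ (hsNormSq b T).toReal := by
    calc ‖T‖ ^ 2 ≤ (√(hsNormSq b T).toReal) ^ 2 := by gcongr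
      _ = _ := Real.sq_sqrt ENNReal.toReal_nonneg
  rw [← ofReal_norm, ← ENNReal.ofReal_pow (norm_nonneg _)]
  exact ENNReal.ofReal_le_of_le_toReal h3

end HilbertSchmidt

/-- A lower bound that loses nothing when `v = 0` and at most one `y i` is nonzero. Every term on
the left has a computable mean for iid summands, so no event "exactly one point in the ball" is
needed. With `A` the sum of norms and `y m` the largest term, the norm `w` on the right is at least
`2‖y m‖ - A - ‖v‖`; combine this with `w² ≥ 2wA - A²` and `∑ ‖y i‖² ≤ ‖y m‖ A`. -/
lemma norm_sum_sub_sq_ge {E ι : Type*} [SeminormedAddCommGroup E] (s : Finset ι) (y : ι → E)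
    (v : E) :
    4 * ∑ i ∈ s, ‖y i‖ ^ 2 - 3 * (∑ i ∈ s, ‖y i‖) ^ 2 - 2 * ‖v‖ * ∑ i ∈ s, ‖y i‖
      ≤ ‖∑ i ∈ s, y i - v‖ ^ 2 := by
  classical
  rcases s.eq_empty_or_nonempty with rfl | hs
  · simp
  obtain ⟨m, hm, hmax⟩ := s.exists_max_image (fun i => ‖y i‖) hs
  set A := ∑ i ∈ s, ‖y i‖ with hA
  have hA0 : 0 ≤ A := Finset.sum_nonneg fun i _ => norm_nonneg _
  have h1 : ∑ i ∈ s, ‖y i‖ ^ 2 ≤ ‖y m‖ * A := by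
    rw [hA, Finset.mul_sum]
    refine Finset.sum_le_sum fun i hi => ?_
    rw [sq]
    exact mul_le_mul_of_nonneg_right (hmax i hi) (norm_nonneg _)
  have h2 : 2 * ‖y m‖ - A - ‖v‖ ≤ ‖∑ i ∈ s, y i - v‖ := by
    have e1 : ∑ i ∈ s, y i - v = y m - (v - ∑ i ∈ s.erase m, y i) := by
      rw [← Finset.add_sum_erase s y hm]; abel
    have e2 : A = ‖y m‖ + ∑ i ∈ s.erase m, ‖y i‖ := by
      rw [hA, ← Finset.add_sum_erase s (fun i => ‖y i‖) hm]
    have e3 := norm_sum_le (s.erase m) y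
    have e4 := norm_sub_norm_le (y m) (v - ∑ i ∈ s.erase m, y i)
    have e5 := norm_sub_le v (∑ i ∈ s.erase m, y i)
    rw [e1]
    linarith
  have h3 : 0 ≤ ‖∑ i ∈ s, y i - v‖ := norm_nonneg _
  nlinarith [sq_nonneg (‖∑ i ∈ s, y i - v‖ - A)]

/-! ### Regularity of the kernel. -/

section Kernel

variable {K : ℝ → ℝ}

lemma KernelAssumption.eq_zero_of_one_lt (hK : KernelAssumption K) {s : ℝ} (hs : 1 < s) :
    K s = 0 := by
  by_contra h
  exact absurd (hK.support_subset h).2 (not_le.mpr hs)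

lemma KernelAssumption.measurable (hK : KernelAssumption K) : Measurable K := by
  classical
  have h : (Icc (0 : ℝ) 1).piecewise K (fun _ => 0) = K := by
    ext s
    by_cases hs : s ∈ Icc (0 : ℝ) 1
    · rw [piecewise_eq_of_mem _ _ _ hs]
    · rw [piecewise_eq_of_notMem _ _ _ hs]
      by_contra hne
      exact hs (hK.support_subset (Ne.symm hne))
  rw [← h]
  exact hK.differentiableOn.continuousOn.measurable_piecewise continuousOn_const measurableSet_Icc

end Kernel

/-! ### The rank-one summand. -/

section LocalTerm

variable {H : Type*} [NormedAddCommGroup H] [InnerProductSpace ℝ H] {K : ℝ → ℝ}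

lemma norm_localTerm (hK : KernelAssumption K) (x₀ : H) (h : ℝ) (x : H) :
    ‖localTerm K x₀ h x‖ = K (‖x - x₀‖ / h) * ‖x - x₀‖ ^ 2 := by
  rw [localTerm, norm_smul, InnerProductSpace.norm_rankOne, Real.norm_of_nonneg (hK.nonneg _), sq]

lemma inner_localTerm (x₀ : H) (h : ℝ) (x u v : H) :
    ⟪localTerm K x₀ h x u, v⟫_ℝ = K (‖x - x₀‖ / h) * (⟪x - x₀, u⟫_ℝ * ⟪x - x₀, v⟫_ℝ) := by
  rw [localTerm, smul_apply, InnerProductSpace.rankOne_apply, real_inner_smul_left,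
    real_inner_smul_left]

lemma localTerm_eq_zero (hK : KernelAssumption K) (x₀ : H) {h : ℝ} (hh : 0 < h) {x : H}
    (hx : h < ‖x - x₀‖) : localTerm K x₀ h x = 0 := by
  rw [localTerm, hK.eq_zero_of_one_lt ((one_lt_div hh).mpr hx), zero_smul]

lemma exists_norm_localTerm_le (hK : KernelAssumption K) (x₀ : H) {h : ℝ} (hh : 0 < h) :
    ∃ C, ∀ x, ‖localTerm K x₀ h x‖ ≤ C := by
  obtain ⟨C, hC⟩ := hK.bounded
  have hC0 : 0 ≤ C := (hK.nonneg 0).trans (hC 0)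
  refine ⟨C * h ^ 2, fun x => ?_⟩
  rcases le_or_gt ‖x - x₀‖ h with hx | hx
  · rw [norm_localTerm hK]
    have := hK.nonneg (‖x - x₀‖ / h)
    gcongr
    exact hC _
  · rw [localTerm_eq_zero hK x₀ hh hx, norm_zero]
    positivity

/-- A rank-one operator has a single nonzero singular value at most, so both norms coincide. -/
lemma hsNormSq_localTerm (b : HilbertBasis ℕ ℝ H) (x₀ : H) (h : ℝ)
    (x : H) : hsNormSq b (localTerm K x₀ h x) = ‖localTerm K x₀ h x‖ₑ ^ 2 := by
  have h1 : ∀ k, ‖localTerm K x₀ h x (b k)‖ₑ ^ 2 =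
      ‖K (‖x - x₀‖ / h)‖ₑ ^ 2 * ‖x - x₀‖ₑ ^ 2 * ‖⟪x - x₀, b k⟫_ℝ‖ₑ ^ 2 := by
    intro k
    simp only [localTerm, smul_apply, InnerProductSpace.rankOne_apply,
      enorm_smul]
    ring
  rw [hsNormSq]
  simp_rw [h1]
  rw [ENNReal.tsum_mul_left, b.tsum_enorm_inner_sq, localTerm, enorm_smul]
  have h2 : ‖InnerProductSpace.rankOne ℝ (x - x₀) (x - x₀)‖ₑ = ‖x - x₀‖ₑ * ‖x - x₀‖ₑ := by
    rw [← ofReal_norm, InnerProductSpace.norm_rankOne, ENNReal.ofReal_mul (norm_nonneg _),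
      ofReal_norm]
  rw [h2]
  ring

variable [TopologicalSpace.SeparableSpace H] [MeasurableSpace H] [BorelSpace H]

lemma stronglyMeasurable_localTerm (hK : KernelAssumption K) (x₀ : H) (h : ℝ) :
    StronglyMeasurable (localTerm K x₀ h) := by
  have : SecondCountableTopology H := UniformSpace.secondCountable_of_separable H
  have h1 : StronglyMeasurable fun x : H => K (‖x - x₀‖ / h) :=
    (hK.measurable.comp (by fun_prop)).stronglyMeasurable
  have h2 : Continuous fun x : H => InnerProductSpace.rankOne ℝ (x - x₀) (x - x₀) :=
    ((InnerProductSpace.rankOne ℝ).continuous.comp (by fun_prop)).clm_apply (by fun_prop)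
  exact h1.smul h2.stronglyMeasurable

lemma measurable_inner_localTerm (hK : KernelAssumption K) (x₀ u v : H) (h : ℝ) :
    Measurable fun x : H => ⟪localTerm K x₀ h x u, v⟫_ℝ :=
  (((ContinuousLinearMap.apply ℝ H u).continuous.comp_stronglyMeasurable
    (stronglyMeasurable_localTerm hK x₀ h)).inner stronglyMeasurable_const).measurable

end LocalTerm

lemma measurableSet_norm_sub_le {Ω H : Type*} [MeasurableSpace Ω] [NormedAddCommGroup H]
    [MeasurableSpace H] [BorelSpace H] {Y : Ω → H} (hY : Measurable Y) (x₀ : H) (h : ℝ) :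
    MeasurableSet {ω | ‖Y ω - x₀‖ ≤ h} :=
  measurableSet_le (by fun_prop) measurable_const

/-! ### Mean squared errors at fixed `h` and `n`. -/

section SecondMoments

variable {Ω H : Type*} [MeasurableSpace Ω] {P : Measure Ω} [IsProbabilityMeasure P]
  [NormedAddCommGroup H] [InnerProductSpace ℝ H] [CompleteSpace H]
  [TopologicalSpace.SeparableSpace H] [MeasurableSpace H] [BorelSpace H]
  {X : ℕ → Ω → H} {x₀ : H} {K : ℝ → ℝ} {h : ℝ}

omit [CompleteSpace H] in
lemma stronglyMeasurable_localTerm_comp (hX : ∀ k, Measurable (X k)) (hK : KernelAssumption K)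
    (k : ℕ) : StronglyMeasurable fun ω => localTerm K x₀ h (X k ω) :=
  (stronglyMeasurable_localTerm hK x₀ h).comp_measurable (hX k)

omit [CompleteSpace H] in
lemma memLp_localTerm (hX : ∀ k, Measurable (X k)) (hK : KernelAssumption K) (hh : 0 < h)
    (k : ℕ) : MemLp (fun ω => localTerm K x₀ h (X k ω)) 2 P := by
  obtain ⟨C, hC⟩ := exists_norm_localTerm_le hK x₀ hh
  exact MemLp.of_bound (stronglyMeasurable_localTerm_comp hX hK k).aestronglyMeasurable C
    (Eventually.of_forall fun ω => hC _)

lemma inner_localCov (hX : ∀ k, Measurable (X k)) (hK : KernelAssumption K) (hh : 0 < h)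
    (u v : H) :
    ⟪localCov P K (X 0) x₀ h u, v⟫_ℝ = ∫ ω, ⟪localTerm K x₀ h (X 0 ω) u, v⟫_ℝ ∂P := by
  have hI := (memLp_localTerm (P := P) (x₀ := x₀) hX hK hh 0).integrable one_le_two
  rw [localCov, ContinuousLinearMap.integral_apply hI, real_inner_comm,
    ← integral_inner (hI.apply_continuousLinearMap u)]
  simp_rw [real_inner_comm v]

omit [CompleteSpace H] in
lemma memLp_inner_localTerm (hX : ∀ k, Measurable (X k)) (hK : KernelAssumption K) (hh : 0 < h)
    (u v : H) (k : ℕ) : MemLp (fun ω => ⟪localTerm K x₀ h (X k ω) u, v⟫_ℝ) 2 P := by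
  obtain ⟨C, hC⟩ := exists_norm_localTerm_le hK x₀ hh
  refine MemLp.of_bound ((measurable_inner_localTerm hK x₀ u v h).comp
    (hX k)).aestronglyMeasurable (C * ‖u‖ * ‖v‖)
    (Eventually.of_forall fun ω => (norm_inner_le_norm _ _).trans ?_)
  gcongr
  exact (ContinuousLinearMap.le_opNorm _ _).trans (by gcongr; exact hC _)

/-- Coordinatewise mean squared error of the empirical local covariance. -/
lemma lintegral_inner_empLocalCov_sub (hX : ∀ k, Measurable (X k)) (hindep : iIndepFun X P)
    (hident : ∀ k, IdentDistrib (X k) (X 0) P P) (hK : KernelAssumption K) (hh : 0 < h)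
    {n : ℕ} (hn : 1 ≤ n) (u v : H) :
    ∫⁻ ω, ‖⟪(empLocalCov K X x₀ h n ω - localCov P K (X 0) x₀ h) u, v⟫_ℝ‖ₑ ^ 2 ∂P =
      ENNReal.ofReal (Var[fun ω => ⟪localTerm K x₀ h (X 0 ω) u, v⟫_ℝ; P] / n) := by
  have hm := measurable_inner_localTerm hK x₀ u v h
  have key := lintegral_sq_sampleMean_sub (P := P)
    (z := fun k ω => ⟪localTerm K x₀ h (X k ω) u, v⟫_ℝ)
    (memLp_inner_localTerm hX hK hh u v)
    (hindep.comp (fun _ x => ⟪localTerm K x₀ h x u, v⟫_ℝ) (fun _ => hm))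
    (fun k => (hident k).comp hm) hn
  rw [← key]
  refine lintegral_congr fun ω => ?_
  rw [sub_apply, inner_sub_left, inner_localCov hX hK hh, empLocalCov,
    smul_apply, sum_apply, real_inner_smul_left, sum_inner]

omit [IsProbabilityMeasure P] in
lemma integral_sq_eq_lintegral {z : Ω → ℝ} (hz : MemLp z 2 P) :
    ENNReal.ofReal (∫ ω, z ω ^ 2 ∂P) = ∫⁻ ω, ‖z ω‖ₑ ^ 2 ∂P := by
  rw [ofReal_integral_eq_lintegral_ofReal hz.integrable_sq
    (Eventually.of_forall fun ω => sq_nonneg _)]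
  refine lintegral_congr fun ω => ?_
  rw [← enorm_pow, Real.enorm_of_nonneg (sq_nonneg _)]

lemma variance_bounds {z : Ω → ℝ} (hz : MemLp z 2 P) {S : Set Ω}
    (hS : MeasurableSet S) (hzS : ∀ ω, ω ∉ S → z ω = 0) :
    (1 - P.real S) * ∫ ω, z ω ^ 2 ∂P ≤ Var[z; P] ∧ Var[z; P] ≤ ∫ ω, z ω ^ 2 ∂P := by
  have h1 := variance_eq_sub hz
  have h2 := sq_integral_le_measureReal_mul hz hS hzS
  simp only [Pi.pow_apply] at h1
  rw [h1]
  constructor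
  · linarith
  · linarith [sq_nonneg (∫ ω, z ω ∂P)]

omit [CompleteSpace H] in
lemma tsum_integral_inner_localTerm_sq (hX : ∀ k, Measurable (X k)) (hK : KernelAssumption K)
    (hh : 0 < h) (b : HilbertBasis ℕ ℝ H) :
    ∑' i, ∑' j, ENNReal.ofReal (∫ ω, ⟪localTerm K x₀ h (X 0 ω) (b i), b j⟫_ℝ ^ 2 ∂P) =
      ENNReal.ofReal (∫ ω, ‖localTerm K x₀ h (X 0 ω)‖ ^ 2 ∂P) := by
  have hm : ∀ i j, Measurable fun ω => ⟪localTerm K x₀ h (X 0 ω) (b i), b j⟫_ℝ := fun i j =>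
    (measurable_inner_localTerm hK x₀ (b i) (b j) h).comp (hX 0)
  have h1 := memLp_localTerm (P := P) (x₀ := x₀) hX hK hh 0
  rw [integral_sq_eq_lintegral h1.norm]
  simp_rw [enorm_norm, ← hsNormSq_localTerm b, hsNormSq_eq_tsum_tsum]
  rw [lintegral_tsum fun i => by
    exact (Measurable.tsum fun j => ((hm i j).enorm.pow_const 2)).aemeasurable]
  refine tsum_congr fun i => ?_
  rw [lintegral_tsum fun j => ((hm i j).enorm.pow_const 2).aemeasurable]
  exact tsum_congr fun j => integral_sq_eq_lintegral (memLp_inner_localTerm hX hK hh _ _ 0)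

/-- Tonelli turns the risk into a double sum of entry variances; the bounds of `variance_bounds`
hold entry by entry with the same ball, hence survive summation. -/
lemma lintegral_hsNormSq_bounds (hX : ∀ k, Measurable (X k)) (hindep : iIndepFun X P)
    (hident : ∀ k, IdentDistrib (X k) (X 0) P P) (hK : KernelAssumption K) (hh : 0 < h)
    {n : ℕ} (hn : 1 ≤ n) (b : HilbertBasis ℕ ℝ H) :
    ENNReal.ofReal ((1 - P.real {ω | ‖X 0 ω - x₀‖ ≤ h}) / n *
        ∫ ω, ‖localTerm K x₀ h (X 0 ω)‖ ^ 2 ∂P) ≤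
      ∫⁻ ω, hsNormSq b (empLocalCov K X x₀ h n ω - localCov P K (X 0) x₀ h) ∂P ∧
    ∫⁻ ω, hsNormSq b (empLocalCov K X x₀ h n ω - localCov P K (X 0) x₀ h) ∂P ≤
      ENNReal.ofReal ((∫ ω, ‖localTerm K x₀ h (X 0 ω)‖ ^ 2 ∂P) / n) := by
  have hm : ∀ i j, Measurable fun ω =>
      ⟪(empLocalCov K X x₀ h n ω - localCov P K (X 0) x₀ h) (b i), b j⟫_ℝ := by
    intro i j
    simp only [sub_apply, inner_sub_left, empLocalCov,
      smul_apply, sum_apply, real_inner_smul_left,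
      sum_inner]
    exact ((Finset.measurable_sum _ fun k _ =>
      (measurable_inner_localTerm hK x₀ (b i) (b j) h).comp (hX k)).const_mul _).sub_const _
  have hrepr : ∫⁻ ω, hsNormSq b (empLocalCov K X x₀ h n ω - localCov P K (X 0) x₀ h) ∂P =
      ∑' i, ∑' j, ENNReal.ofReal
        (Var[fun ω => ⟪localTerm K x₀ h (X 0 ω) (b i), b j⟫_ℝ; P] / n) := by
    simp_rw [hsNormSq_eq_tsum_tsum]
    rw [lintegral_tsum fun i => by
      exact (Measurable.tsum fun j => ((hm i j).enorm.pow_const 2)).aemeasurable]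
    refine tsum_congr fun i => ?_
    rw [lintegral_tsum fun j => ((hm i j).enorm.pow_const 2).aemeasurable]
    exact tsum_congr fun j => lintegral_inner_empLocalCov_sub hX hindep hident hK hh hn _ _
  have hvar : ∀ i j, _ := fun i j => variance_bounds
    (memLp_inner_localTerm (P := P) (x₀ := x₀) hX hK hh (b i) (b j) 0)
    (measurableSet_norm_sub_le (hX 0) x₀ h) (fun ω hω => by
      rw [localTerm_eq_zero hK x₀ hh (not_le.mp hω)]; simp)
  have hscale : ∀ c : ℝ, 0 ≤ c →
      ∑' i, ∑' j, ENNReal.ofReal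
        (c * ∫ ω, ⟪localTerm K x₀ h (X 0 ω) (b i), b j⟫_ℝ ^ 2 ∂P) =
      ENNReal.ofReal (c * ∫ ω, ‖localTerm K x₀ h (X 0 ω)‖ ^ 2 ∂P) := by
    intro c hc
    simp_rw [ENNReal.ofReal_mul hc, ENNReal.tsum_mul_left]
    rw [tsum_integral_inner_localTerm_sq hX hK hh b]
  have hp : P.real {ω | ‖X 0 ω - x₀‖ ≤ h} ≤ 1 := measureReal_le_one
  rw [hrepr]
  constructor
  · rw [← hscale _ (div_nonneg (by linarith) (by positivity))]
    refine ENNReal.tsum_le_tsum fun i => ENNReal.tsum_le_tsum fun j =>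
      ENNReal.ofReal_le_ofReal ?_
    rw [div_mul_eq_mul_div]
    gcongr
    exact (hvar i j).1
  · rw [div_eq_inv_mul, ← hscale _ (by positivity)]
    refine ENNReal.tsum_le_tsum fun i => ENNReal.tsum_le_tsum fun j =>
      ENNReal.ofReal_le_ofReal ?_
    rw [div_eq_inv_mul]
    gcongr
    exact (hvar i j).2

omit [CompleteSpace H] in
lemma memLp_empLocalCov_sub (hX : ∀ k, Measurable (X k))
    (hK : KernelAssumption K) (hh : 0 < h) (n : ℕ) (T : H →L[ℝ] H) :
    MemLp (fun ω => empLocalCov K X x₀ h n ω - T) 2 P := by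
  refine MemLp.sub ?_ (memLp_const _)
  have hsum : MemLp (fun ω => ∑ k ∈ Finset.range n, localTerm K x₀ h (X k ω)) 2 P :=
    memLp_finsetSum (f := fun k ω => localTerm K x₀ h (X k ω)) (Finset.range n)
      fun k _ => memLp_localTerm hX hK hh k
  exact hsum.const_smul (n : ℝ)⁻¹

lemma integral_norm_empLocalCov_sub_sq_le (hX : ∀ k, Measurable (X k)) (hindep : iIndepFun X P)
    (hident : ∀ k, IdentDistrib (X k) (X 0) P P) (hK : KernelAssumption K) (hh : 0 < h)
    {n : ℕ} (hn : 1 ≤ n) (b : HilbertBasis ℕ ℝ H) :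
    ∫ ω, ‖empLocalCov K X x₀ h n ω - localCov P K (X 0) x₀ h‖ ^ 2 ∂P ≤
      (∫ ω, ‖localTerm K x₀ h (X 0 ω)‖ ^ 2 ∂P) / n := by
  have h0 : 0 ≤ (∫ ω, ‖localTerm K x₀ h (X 0 ω)‖ ^ 2 ∂P) / n :=
    div_nonneg (integral_nonneg fun ω => sq_nonneg _) (by positivity)
  rw [← ENNReal.ofReal_le_ofReal_iff h0, integral_sq_eq_lintegral
    (memLp_empLocalCov_sub hX hK hh n _).norm]
  refine le_trans ?_ (lintegral_hsNormSq_bounds (x₀ := x₀) hX hindep hident hK hh hn b).2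
  refine lintegral_mono fun ω => ?_
  rw [enorm_norm]
  exact enorm_sq_le_hsNormSq b _

omit [CompleteSpace H] in
lemma le_integral_norm_empLocalCov_sub_sq (hX : ∀ k, Measurable (X k)) (hindep : iIndepFun X P)
    (hident : ∀ k, IdentDistrib (X k) (X 0) P P) (hK : KernelAssumption K) (hh : 0 < h)
    {n : ℕ} (hn : 1 ≤ n) :
    (1 - 5 * n * P.real {ω | ‖X 0 ω - x₀‖ ≤ h}) *
        ((∫ ω, ‖localTerm K x₀ h (X 0 ω)‖ ^ 2 ∂P) / n) ≤
      ∫ ω, ‖empLocalCov K X x₀ h n ω - localCov P K (X 0) x₀ h‖ ^ 2 ∂P := by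
  have hn0 : (0 : ℝ) < n := by exact_mod_cast hn
  set a : ℕ → Ω → ℝ := fun k ω => ‖localTerm K x₀ h (X k ω)‖ with ha
  set G := localCov P K (X 0) x₀ h with hG
  have hmeas : Measurable fun x => ‖localTerm K x₀ h x‖ :=
    (stronglyMeasurable_localTerm hK x₀ h).norm.measurable
  have hLp : ∀ k, MemLp (a k) 2 P := fun k => (memLp_localTerm hX hK hh k).norm
  have hi : iIndepFun a P := hindep.comp (fun _ x => ‖localTerm K x₀ h x‖) (fun _ => hmeas)
  have hid : ∀ k, IdentDistrib (a k) (a 0) P P := fun k => (hident k).comp hmeas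
  set p := P.real {ω | ‖X 0 ω - x₀‖ ≤ h} with hp
  set m := ∫ ω, a 0 ω ∂P with hm
  set A := ∫ ω, a 0 ω ^ 2 ∂P with hA
  have hm0 : 0 ≤ m := integral_nonneg fun ω => norm_nonneg _
  have hmA : m ^ 2 ≤ p * A := sq_integral_le_measureReal_mul (hLp 0)
    (measurableSet_norm_sub_le (hX 0) x₀ h) (fun ω hω => by
      simp [ha, localTerm_eq_zero hK x₀ hh (not_le.mp hω)])
  have hGm : ‖G‖ ≤ m := norm_integral_le_integral_norm _
  have hsumLp : MemLp (fun ω => ∑ k ∈ Finset.range n, a k ω) 2 P :=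
    memLp_finsetSum _ fun k _ => hLp k
  have hE1 : ∫ ω, ∑ k ∈ Finset.range n, a k ω ∂P = n * m :=
    integral_sum_range_of_identDistrib hLp hid n
  have hE2 : ∫ ω, ∑ k ∈ Finset.range n, a k ω ^ 2 ∂P = n * A := by
    rw [integral_finsetSum _ fun k _ => (hLp k).integrable_sq]
    have : ∀ k, ∫ ω, a k ω ^ 2 ∂P = A := fun k => (hid k).sq.integral_eq
    simp [this]
  have hE3 : ∫ ω, (∑ k ∈ Finset.range n, a k ω) ^ 2 ∂P = n * (A - m ^ 2) + (n * m) ^ 2 := by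
    have hv := variance_eq_sub hsumLp
    have hv0 := variance_eq_sub (hLp 0)
    have hs : (fun ω => ∑ k ∈ Finset.range n, a k ω) = ∑ k ∈ Finset.range n, a k := by
      ext ω; simp
    rw [hE1] at hv
    rw [hs, variance_sum_range_of_iid hLp hi hid, ← hs, hv0] at hv
    simp only [Pi.pow_apply] at hv
    rw [← hA, ← hm] at hv
    linarith
  have hpt : ∀ ω, (n : ℝ)⁻¹ ^ 2 * (4 * ∑ k ∈ Finset.range n, a k ω ^ 2
      - 3 * (∑ k ∈ Finset.range n, a k ω) ^ 2 - 2 * (n * ‖G‖) * ∑ k ∈ Finset.range n, a k ω) ≤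
      ‖empLocalCov K X x₀ h n ω - G‖ ^ 2 := by
    intro ω
    have h1 := norm_sum_sub_sq_ge (Finset.range n) (fun k => localTerm K x₀ h (X k ω))
      ((n : ℝ) • G)
    have h2 : empLocalCov K X x₀ h n ω - G =
        (n : ℝ)⁻¹ • (∑ k ∈ Finset.range n, localTerm K x₀ h (X k ω) - (n : ℝ) • G) := by
      rw [smul_sub, inv_smul_smul₀ hn0.ne', empLocalCov]
    rw [h2, norm_smul, mul_pow, Real.norm_of_nonneg (inv_nonneg.mpr hn0.le)]
    rw [norm_smul, Real.norm_of_nonneg hn0.le] at h1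
    gcongr
  have hi1 : Integrable (fun ω => ∑ k ∈ Finset.range n, a k ω) P := hsumLp.integrable one_le_two
  have hi2 : Integrable (fun ω => ∑ k ∈ Finset.range n, a k ω ^ 2) P :=
    integrable_finsetSum _ fun k _ => (hLp k).integrable_sq
  have hi3 : Integrable (fun ω => (∑ k ∈ Finset.range n, a k ω) ^ 2) P := hsumLp.integrable_sq
  have hint := integral_mono (((hi2.const_mul 4).sub (hi3.const_mul 3)).sub
    (hi1.const_mul (2 * (n * ‖G‖))) |>.const_mul ((n : ℝ)⁻¹ ^ 2))
    (memLp_empLocalCov_sub hX hK hh n G).norm.integrable_sq hpt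
  refine le_trans ?_ hint
  simp only [Pi.sub_apply]
  rw [integral_const_mul, integral_sub (by fun_prop) (by fun_prop),
    integral_sub (by fun_prop) (by fun_prop), integral_const_mul, integral_const_mul,
    integral_const_mul, hE1, hE2, hE3]
  -- The constant 5 is 3 + 2: `3 n² m²` from the squared sum and at most `2 n² m²` from the
  -- centring, as `‖G‖ ≤ m`; then `m² ≤ p A`.
  have hfin : n * A - 5 * n ^ 2 * (p * A) ≤ 4 * (n * A) - 3 * (n * (A - m ^ 2) + (n * m) ^ 2)
      - 2 * (n * ‖G‖) * (n * m) := by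
    have e1 : (n : ℝ) ^ 2 * (‖G‖ * m) ≤ n ^ 2 * (m * m) := by gcongr
    have e2 : (n : ℝ) ^ 2 * m ^ 2 ≤ n ^ 2 * (p * A) := by gcongr
    have e3 : 0 ≤ (n : ℝ) * m ^ 2 := by positivity
    nlinarith
  calc (1 - 5 * n * p) * (A / n) = (n : ℝ)⁻¹ ^ 2 * (n * A - 5 * n ^ 2 * (p * A)) := by
        field_simp
    _ ≤ _ := by gcongr

end SecondMoments

/-! ### Rapid variation and small ball probabilities. -/

lemma GammaVarying.eventually_pos {F : ℝ → ℝ} (hF : GammaVarying F) (hnn : ∀ t, 0 ≤ F t) :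
    ∀ᶠ h in 𝓝[>] 0, 0 < F h := by
  obtain ⟨ρ, -, -, hlim⟩ := hF
  -- At `x = 0` the quotient is `F h / F h`, which is 0 by convention when `F h = 0`, yet it tends
  -- to 1.
  filter_upwards [(hlim 0).eventually_ne (Real.exp_ne_zero 0)] with h hh
  refine lt_of_le_of_ne (hnn h) fun h0 => hh ?_
  simp [← h0]

/-- A monotone `Γ`-varying function vanishing on `(-∞, 0]` is rapidly varying at `0`. -/
lemma GammaVarying.eventually_le_mul {F : ℝ → ℝ} (hF : GammaVarying F) (hmono : Monotone F)
    (hnonpos : ∀ t ≤ 0, F t = 0) {s : ℝ} (hs : s < 1) {ε : ℝ} (hε : 0 < ε) :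
    ∀ᶠ h in 𝓝[>] 0, F (s * h) ≤ ε * F h := by
  have hnn : ∀ t, 0 ≤ F t := fun t => by
    rcases le_total t 0 with ht | ht
    · exact (hnonpos t ht).ge
    · exact (hnonpos 0 le_rfl).symm.le.trans (hmono ht)
  have hpos := hF.eventually_pos hnn
  obtain ⟨ρ, -, -, hlim⟩ := hF
  set M := -Real.log (ε / 2) with hM
  have hexp : Real.exp (-M) < ε := by
    rw [hM, neg_neg, Real.exp_log (by positivity)]
    linarith
  filter_upwards [hpos, (hlim (-M)).eventually_lt_const hexp,
    (hlim (-M / (1 - s))).eventually_ne (Real.exp_ne_zero _)] with h hFh h1 h2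
  -- The limit at this `x` is nonzero while `F` vanishes on the nonpositive reals. This yields `ρ h
  -- * M < (1 - s) h`, hence `s h ≤ h - ρ h * M`, where `F` is below `ε F(h)`.
  have h3 : 0 < h + ρ h * (-M / (1 - s)) := by
    by_contra hcon
    exact h2 (by rw [hnonpos _ (not_lt.mp hcon), zero_div])
  have h4 : s * h ≤ h + ρ h * -M := by
    have hs' : 0 < 1 - s := by linarith
    have : (h + ρ h * (-M / (1 - s))) * (1 - s) = h * (1 - s) + ρ h * -M := by
      field_simp
    nlinarith [mul_pos h3 hs']
  exact (hmono h4).trans ((div_lt_iff₀ hFh).mp h1).le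

section SmallBall

variable {Ω H : Type*} [MeasurableSpace Ω] {P : Measure Ω} [IsProbabilityMeasure P]
  [NormedAddCommGroup H] [InnerProductSpace ℝ H] {Y : Ω → H} {x₀ : H}

omit [InnerProductSpace ℝ H] in
lemma smallBall_mono : Monotone (smallBall P Y x₀) := fun _ _ hst =>
  measureReal_mono fun _ hω => lt_of_lt_of_le hω hst

omit [IsProbabilityMeasure P] [InnerProductSpace ℝ H] in
lemma smallBall_of_nonpos {t : ℝ} (ht : t ≤ 0) : smallBall P Y x₀ t = 0 := by
  have : {ω | ‖Y ω - x₀‖ < t} = ∅ := by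
    ext ω
    simpa using ht.trans (norm_nonneg _)
  simp [smallBall, this]

variable [MeasurableSpace H] [BorelSpace H]

omit [IsProbabilityMeasure P] in
lemma LawAssumption.eventually_measure_norm_eq (hA : LawAssumption P Y x₀) (hY : Measurable Y) :
    ∀ᶠ h in 𝓝 0, P {ω | ‖Y ω - x₀‖ = h} = 0 := by
  obtain ⟨-, g, ρ, r, hr, -, -, hg, -⟩ := hA
  filter_upwards [Ioo_mem_nhds (neg_lt_zero.mpr hr) hr] with h hh
  have hm : Measurable fun ω => ‖Y ω - x₀‖ := by fun_prop
  have h1 := congrArg (fun μ : Measure ℝ => μ {h}) hg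
  simp only [Measure.restrict_apply (measurableSet_singleton h),
    inter_eq_left.mpr (singleton_subset_iff.mpr hh), measure_singleton] at h1
  rwa [Measure.map_apply hm (measurableSet_singleton h)] at h1

lemma LawAssumption.eventually_measureReal_norm_le (hA : LawAssumption P Y x₀)
    (hY : Measurable Y) :
    ∀ᶠ h in 𝓝 0, P.real {ω | ‖Y ω - x₀‖ ≤ h} = smallBall P Y x₀ h := by
  filter_upwards [hA.eventually_measure_norm_eq hY] with h hh
  refine le_antisymm ?_ (measureReal_mono fun ω (hω : ‖Y ω - x₀‖ < h) => hω.le)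
  have : {ω | ‖Y ω - x₀‖ ≤ h} = {ω | ‖Y ω - x₀‖ < h} ∪ {ω | ‖Y ω - x₀‖ = h} := by
    ext ω
    exact le_iff_lt_or_eq (a := ‖Y ω - x₀‖)
  rw [this]
  refine (measureReal_union_le _ _).trans ?_
  simp [smallBall, measureReal_def, hh]

/-- Right continuity of the distribution function at 0, where there is no atom. -/
lemma LawAssumption.tendsto_measureReal_norm_le (hA : LawAssumption P Y x₀) (hY : Measurable Y) :
    Tendsto (fun h => P.real {ω | ‖Y ω - x₀‖ ≤ h}) (𝓝[>] 0) (𝓝 0) := by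
  have hm : Measurable fun ω => ‖Y ω - x₀‖ := by fun_prop
  have : IsProbabilityMeasure (P.map fun ω => ‖Y ω - x₀‖) :=
    Measure.isProbabilityMeasure_map hm.aemeasurable
  have hcdf : ∀ h, cdf (P.map fun ω => ‖Y ω - x₀‖) h = P.real {ω | ‖Y ω - x₀‖ ≤ h} := by
    intro h
    rw [cdf_eq_real, map_measureReal_apply hm measurableSet_Iic]
    rfl
  have h1 := ((cdf (P.map fun ω => ‖Y ω - x₀‖)).right_continuous 0).tendsto.mono_left
    (nhdsWithin_mono _ Ioi_subset_Ici_self)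
  rw [hcdf, (hA.eventually_measureReal_norm_le hY).self_of_nhds, smallBall_of_nonpos le_rfl] at h1
  exact h1.congr hcdf

end SmallBall

/-! ### Asymptotics of `E‖Y‖²` as `h → 0+`. -/

section Asymptotics

variable {Ω H : Type*} [MeasurableSpace Ω] {P : Measure Ω} [IsProbabilityMeasure P]
  [NormedAddCommGroup H] [InnerProductSpace ℝ H]
  [TopologicalSpace.SeparableSpace H] [MeasurableSpace H] [BorelSpace H]
  {X : ℕ → Ω → H} {x₀ : H} {K : ℝ → ℝ}

lemma KernelAssumption.exists_sq_mul_pow_near (hK : KernelAssumption K) {η : ℝ} (hη : 0 < η) :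
    ∃ s, 0 < s ∧ s < 1 ∧ ∀ u ∈ Icc s 1, |K u ^ 2 * u ^ 4 - K 1 ^ 2| ≤ η := by
  have hc : ContinuousWithinAt (fun u => K u ^ 2 * u ^ 4) (Icc 0 1) 1 :=
    ((hK.differentiableOn.continuousOn 1 (by simp)).pow 2).mul
      (continuousWithinAt_id.pow 4)
  obtain ⟨d, hd, hball⟩ := Metric.continuousWithinAt_iff.mp hc η hη
  refine ⟨max (1 / 2) (1 - d / 2), by positivity, max_lt (by norm_num) (by linarith),
    fun u hu => ?_⟩
  have hu1 := (le_max_left _ _).trans hu.1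
  have hu2 := (le_max_right _ _).trans hu.1
  have := hball (x := u) ⟨by linarith, hu.2⟩ (by
    rw [Real.dist_eq, abs_lt]
    constructor <;> linarith [hu.2])
  simpa [Real.dist_eq] using this.le

lemma eventually_integral_norm_localTerm_sq (hX : ∀ k, Measurable (X k))
    (hF : GammaVarying (smallBall P (X 0) x₀)) (hA : LawAssumption P (X 0) x₀)
    (hK : KernelAssumption K) {ε : ℝ} (hε : 0 < ε) :
    ∀ᶠ h in 𝓝[>] 0, |∫ ω, ‖localTerm K x₀ h (X 0 ω)‖ ^ 2 ∂P
      - h ^ 4 * smallBall P (X 0) x₀ h * K 1 ^ 2| ≤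
        ε * (h ^ 4 * smallBall P (X 0) x₀ h * K 1 ^ 2) := by
  have hK1 := hK.pos_one
  obtain ⟨C, hC⟩ := hK.bounded
  set η := ε * K 1 ^ 2 / 2 with hη
  have hη0 : 0 < η := by positivity
  obtain ⟨s, hs0, hs1, hs⟩ := hK.exists_sq_mul_pow_near hη0
  set D := C ^ 2 + K 1 ^ 2 with hD
  have hD0 : 0 < D := by positivity
  filter_upwards [hF.eventually_le_mul smallBall_mono (fun t => smallBall_of_nonpos) hs1
      (div_pos hη0 hD0), self_mem_nhdsWithin,
    nhdsWithin_le_nhds (hA.eventually_measureReal_norm_le (hX 0))] with h hsmall hh hle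
  replace hh : 0 < h := hh
  set S := {ω | ‖X 0 ω - x₀‖ ≤ h} with hS
  set T := {ω | ‖X 0 ω - x₀‖ < s * h} with hT
  have hSm : MeasurableSet S := measurableSet_norm_sub_le (hX 0) x₀ h
  have hTm : MeasurableSet T := by
    have := hX 0
    exact measurableSet_lt (by fun_prop) measurable_const
  -- In the shell `s ≤ u ≤ 1` continuity of `K` at 1 gives error `η`; in the inner ball the crude
  -- bound `D` suffices, since its mass is at most `η / D * F(h)`. The two contributions total `2 η
  -- h⁴ F(h)`, whence `η = ε K(1)² / 2`.
  have hpt : ∀ ω, |‖localTerm K x₀ h (X 0 ω)‖ ^ 2 - S.indicator (fun _ => h ^ 4 * K 1 ^ 2) ω| ≤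
      S.indicator (fun _ => h ^ 4 * η) ω + T.indicator (fun _ => h ^ 4 * D) ω := by
    intro ω
    by_cases hωS : ω ∈ S
    · set u := ‖X 0 ω - x₀‖ / h with hu
      have hu0 : 0 ≤ u := by positivity
      have hu1 : u ≤ 1 := (div_le_one hh).mpr hωS
      have e1 : ‖localTerm K x₀ h (X 0 ω)‖ ^ 2 = h ^ 4 * (K u ^ 2 * u ^ 4) := by
        rw [norm_localTerm hK, ← hu]
        have : ‖X 0 ω - x₀‖ = u * h := by rw [hu]; field_simp
        rw [this]; ring
      rw [e1, indicator_of_mem hωS, indicator_of_mem hωS, ← mul_sub, abs_mul,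
        abs_of_pos (by positivity : 0 < h ^ 4)]
      by_cases hωT : ω ∈ T
      · rw [indicator_of_mem hωT, ← mul_add]
        have e2 : K u ^ 2 * u ^ 4 ≤ C ^ 2 * 1 := by
          have := hK.nonneg u
          have := hC u
          have := pow_le_one₀ hu0 hu1 (n := 4)
          gcongr
        have e3 : 0 ≤ K u ^ 2 * u ^ 4 := by positivity
        have e4 : |K u ^ 2 * u ^ 4 - K 1 ^ 2| ≤ D := by
          rw [abs_le]
          constructor <;> nlinarith [sq_nonneg C, sq_nonneg (K 1)]
        gcongr
        linarith
      · rw [indicator_of_notMem hωT, add_zero]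
        gcongr
        exact hs u ⟨(le_div_iff₀ hh).mpr (not_lt.mp hωT), hu1⟩
    · have hωT : ω ∉ T := fun (hT' : ‖X 0 ω - x₀‖ < s * h) => hωS (hT'.le.trans (mul_le_of_le_one_left hh.le hs1.le))
      rw [localTerm_eq_zero hK x₀ hh (not_le.mp hωS)]
      simp [hωS, hωT]
  have hI1 := (memLp_localTerm (P := P) (x₀ := x₀) hX hK hh 0).norm.integrable_sq
  have hI2 : Integrable (S.indicator (fun _ => h ^ 4 * K 1 ^ 2)) P :=
    (integrable_const _).indicator hSm
  have hI3 : Integrable (S.indicator (fun _ => h ^ 4 * η)) P :=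
    (integrable_const _).indicator hSm
  have hI4 : Integrable (T.indicator (fun _ => h ^ 4 * D)) P :=
    (integrable_const _).indicator hTm
  have hint := (abs_integral_le_integral_abs (μ := P)
    (f := fun ω => ‖localTerm K x₀ h (X 0 ω)‖ ^ 2 - S.indicator (fun _ => h ^ 4 * K 1 ^ 2) ω)).trans
    (integral_mono (hI1.sub hI2).abs (hI3.add hI4) hpt)
  simp only [Pi.add_apply] at hint
  rw [integral_sub hI1 hI2, integral_add hI3 hI4, integral_indicator_const _ hSm,
    integral_indicator_const _ hSm, integral_indicator_const _ hTm, hle] at hint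
  have hTF : P.real T = smallBall P (X 0) x₀ (s * h) := rfl
  rw [hTF] at hint
  simp only [smul_eq_mul] at hint
  have e5 : smallBall P (X 0) x₀ (s * h) * D ≤ η * smallBall P (X 0) x₀ h := by
    calc _ ≤ η / D * smallBall P (X 0) x₀ h * D := by gcongr
      _ = _ := by field_simp
  have e6 : h ^ 4 * (smallBall P (X 0) x₀ (s * h) * D) ≤
      h ^ 4 * (η * smallBall P (X 0) x₀ h) := by gcongr
  calc _ = |∫ ω, ‖localTerm K x₀ h (X 0 ω)‖ ^ 2 ∂P
        - smallBall P (X 0) x₀ h * (h ^ 4 * K 1 ^ 2)| := by ring_nf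
    _ ≤ 2 * (h ^ 4 * (η * smallBall P (X 0) x₀ h)) := by linarith
    _ = _ := by rw [hη]; ring

end Asymptotics

/-! ### Assembly of the asymptotic statements. -/

theorem theorem3 {Ω H : Type*} [MeasurableSpace Ω] (P : Measure Ω) [IsProbabilityMeasure P]
    [NormedAddCommGroup H] [InnerProductSpace ℝ H] [CompleteSpace H]
    [TopologicalSpace.SeparableSpace H] [MeasurableSpace H] [BorelSpace H]
    (X : ℕ → Ω → H) (hX : ∀ k, Measurable (X k)) (hindep : iIndepFun X P)
    (hident : ∀ k, IdentDistrib (X k) (X 0) P P)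
    (x₀ : H) (K : ℝ → ℝ)
    (hF : GammaVarying (smallBall P (X 0) x₀))
    (hA1 : LawAssumption P (X 0) x₀) (hA2 : KernelAssumption K)
    (b : HilbertBasis ℕ ℝ H) :
    -- Hilbert-Schmidt norm, with `o(1)` as `h → 0` uniform in `n`
    (∀ ε > 0, ∃ δ > 0, ∀ h, 0 < h → h < δ → ∀ n : ℕ, 1 ≤ n →
      |(∫⁻ ω, hsNormSq b (empLocalCov K X x₀ h n ω - localCov P K (X 0) x₀ h) ∂P).toReal
          - h ^ 4 * smallBall P (X 0) x₀ h / n * K 1 ^ 2|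
        ≤ ε * (h ^ 4 * smallBall P (X 0) x₀ h / n * K 1 ^ 2)) ∧
    -- operator norm: upper bound uniform in `n`, and equality as `h → 0` and `n F(h) → 0`
    (∀ ε > 0, ∃ δ > 0, ∀ h, 0 < h → h < δ → ∀ n : ℕ, 1 ≤ n →
      (∫ ω, ‖empLocalCov K X x₀ h n ω - localCov P K (X 0) x₀ h‖ ^ 2 ∂P
        ≤ (1 + ε) * (h ^ 4 * smallBall P (X 0) x₀ h / n * K 1 ^ 2)) ∧
      (n * smallBall P (X 0) x₀ h < δ →
        (1 - ε) * (h ^ 4 * smallBall P (X 0) x₀ h / n * K 1 ^ 2)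
          ≤ ∫ ω, ‖empLocalCov K X x₀ h n ω - localCov P K (X 0) x₀ h‖ ^ 2 ∂P)) := by
  have hmain : ∀ ε > 0, ∃ η, 0 < η ∧ η ≤ 1 ∧ 12 * η ≤ ε ∧ ∃ δ > 0, δ ≤ η ∧ ∀ h, 0 < h → h < δ →
      |∫ ω, ‖localTerm K x₀ h (X 0 ω)‖ ^ 2 ∂P - h ^ 4 * smallBall P (X 0) x₀ h * K 1 ^ 2| ≤
        η * (h ^ 4 * smallBall P (X 0) x₀ h * K 1 ^ 2) ∧
      P.real {ω | ‖X 0 ω - x₀‖ ≤ h} ≤ η ∧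
      P.real {ω | ‖X 0 ω - x₀‖ ≤ h} = smallBall P (X 0) x₀ h := by
    intro ε hε
    have hη : 0 < min 1 (ε / 12) := by positivity
    refine ⟨min 1 (ε / 12), hη, min_le_left _ _,
      by linarith [min_le_right 1 (ε / 12)], ?_⟩
    have hev := (eventually_integral_norm_localTerm_sq hX hF hA1 hA2 hη).and
      (((hA1.tendsto_measureReal_norm_le (hX 0)).eventually_le_const hη).and
        (nhdsWithin_le_nhds (hA1.eventually_measureReal_norm_le (hX 0))))
    obtain ⟨δ, hδ, hsub⟩ := mem_nhdsGT_iff_exists_Ioo_subset.mp hev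
    -- Keeping `δ ≤ η` lets the hypothesis `n F(h) < δ` serve as `n F(h) ≤ η`.
    refine ⟨min δ (min 1 (ε / 12)), lt_min hδ hη, min_le_right _ _, fun h hh hhδ => ?_⟩
    exact hsub ⟨hh, hhδ.trans_le (min_le_left _ _)⟩
  constructor
  · intro ε hε
    obtain ⟨η, hη0, hη1, hηε, δ, hδ0, -, hδ⟩ := hmain ε hε
    refine ⟨δ, hδ0, fun h hh hhδ n hn => ?_⟩
    obtain ⟨hA, hp, -⟩ := hδ h hh hhδ
    have hn0 : (0 : ℝ) < n := by exact_mod_cast hn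
    obtain ⟨hlow, hup⟩ := lintegral_hsNormSq_bounds (x₀ := x₀) hX hindep hident hA2 hh hn b
    set V := ∫⁻ ω, hsNormSq b (empLocalCov K X x₀ h n ω - localCov P K (X 0) x₀ h) ∂P
    set A := ∫ ω, ‖localTerm K x₀ h (X 0 ω)‖ ^ 2 ∂P
    set p := P.real {ω | ‖X 0 ω - x₀‖ ≤ h}
    have hA0 : 0 ≤ A := integral_nonneg fun ω => sq_nonneg _
    have hV : V ≠ ∞ := ne_top_of_le_ne_top ENNReal.ofReal_ne_top hup
    have hup' : V.toReal ≤ A / n := ENNReal.toReal_le_of_le_ofReal (by positivity) hup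
    have hlow' : (1 - p) / n * A ≤ V.toReal := (ENNReal.ofReal_le_iff_le_toReal hV).mp hlow
    have hM : h ^ 4 * smallBall P (X 0) x₀ h / n * K 1 ^ 2 =
        h ^ 4 * smallBall P (X 0) x₀ h * K 1 ^ 2 / n := by ring
    rw [hM]
    set M := h ^ 4 * smallBall P (X 0) x₀ h * K 1 ^ 2
    rw [abs_le] at hA
    have hM0 : 0 ≤ M := by nlinarith [hA.1, hA.2]
    have e1 : A ≤ (1 + ε) * M := by nlinarith [hA.2]
    have e2 : (1 - ε) * M ≤ (1 - p) * A := by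
      nlinarith [hA.1, hA.2, mul_le_mul_of_nonneg_right hp hA0]
    have e3 : A / n ≤ (1 + ε) * M / n := by gcongr
    have e4 : (1 - ε) * M / n ≤ (1 - p) * A / n := by gcongr
    have e5 : (1 - p) / n * A = (1 - p) * A / n := by ring
    rw [e5] at hlow'
    rw [mul_div_assoc] at e3 e4
    rw [abs_le]
    constructor <;> linarith
  · intro ε hε
    obtain ⟨η, hη0, hη1, hηε, δ, hδ0, hδη, hδ⟩ := hmain ε hε
    refine ⟨δ, hδ0, fun h hh hhδ n hn => ?_⟩
    obtain ⟨hA, -, hpF⟩ := hδ h hh hhδ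
    have hn0 : (0 : ℝ) < n := by exact_mod_cast hn
    have hup := integral_norm_empLocalCov_sub_sq_le (x₀ := x₀) hX hindep hident hA2 hh hn b
    have hlow := le_integral_norm_empLocalCov_sub_sq (x₀ := x₀) hX hindep hident hA2 hh hn
    rw [hpF] at hlow
    set A := ∫ ω, ‖localTerm K x₀ h (X 0 ω)‖ ^ 2 ∂P
    have hA0 : 0 ≤ A := integral_nonneg fun ω => sq_nonneg _
    have hM : h ^ 4 * smallBall P (X 0) x₀ h / n * K 1 ^ 2 =
        h ^ 4 * smallBall P (X 0) x₀ h * K 1 ^ 2 / n := by ring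
    rw [hM]
    set M := h ^ 4 * smallBall P (X 0) x₀ h * K 1 ^ 2
    rw [abs_le] at hA
    have hM0 : 0 ≤ M := by nlinarith [hA.1, hA.2]
    constructor
    · refine hup.trans ?_
      rw [← mul_div_assoc]
      gcongr
      nlinarith [hA.2]
    · intro hnF
      refine le_trans ?_ hlow
      rw [← mul_div_assoc, ← mul_div_assoc]
      refine div_le_div_of_nonneg_right ?_ hn0.le
      -- As `A ≤ (1 + η) M ≤ 2M`, the loss `5 n F(h) A` is at most `10 η M`; with `A ≥ (1 - η) M`
      -- the total loss is `11 η M`, within `12 η ≤ ε`.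
      have e1 := mul_le_mul_of_nonneg_right (hnF.le.trans hδη) hA0
      have e2 : η * A ≤ η * (2 * M) := by
        gcongr
        nlinarith [hA.2]
      nlinarith [hA.1]
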